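/- Let $n$ be a non-negative integer, equip $\mathbb R^n$ with the Euclidean metric $d$, and let $\mathcal K(\mathbb R^n)$ be the space of nonempty compact subsets of $\mathbb R^n$ with the Hausdorff metric. Let $\ell_\infty(\mathbb R^n)$ be the set of bounded sequences in $\mathbb R^n$ with the supremum metric $d_1((x_k),(y_k))=\sup_k d(x_k,y_k)$. A $GIFS_\infty$ on $\mathbb R^n$ is a finite nonempty family $\mathcal F$ of maps $f:\ell_\infty(\mathbb R^n)\to\mathbb R^n$ such that each $f\in\mathcal F$ is a contraction, $\operatorname{Lip}(f)<1$, and satisfies condition (C1): for every bounded sequence $(K_k)$ in $\mathcal K(\mathbb R^n)$, $\overline{f\left(\prod_{k=1}^\infty K_k\right)}\in\mathcal K(\mathbb R^n)$. The attractor (fractal) of $\mathcal F$ is the unique $A\in\mathcal K(\mathbb R^n)$ such that $$A=\bigcup_{f\in\mathcal F}\overline{f(A\times A\times\cdots)}.$$ Then a typical compact set $K\subset\mathbb R^n$ has the following property: for every $r\in(0,1)$ there is a $GIFS_\infty$ $\mathcal F$ on $\mathbb R^n$ such that $K$ is the attractor of $\mathcal F$ and $\operatorname{Lip}(f)\le r$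 for every $f\in\mathcal F$. That is, the set of those $K\in\mathcal K(\mathbb R^n)$ that have this property is co-meager in $\mathcal K(\mathbb R^n)$. -/

import Mathlib

open Filter TopologicalSpace
open scoped NNReal BoundedContinuousFunction

namespace GIFSInfinity

/-- `ℓ_∞(X)`: the bounded sequences in the metric space `X`, with the supremum metric
(as `ℕ` is discrete, every sequence is continuous). -/
abbrev EllInfty (X : Type*) [MetricSpace X] : Type _ := ℕ →ᵇ X

/-- The product `∏ₖ Aₖ`, as a set of sequences in `ℓ_∞(X)`. When `⋃ₖ Aₖ` is bounded, every
sequence with `xₖ ∈ Aₖ` for all `k` is bounded, so that this is the whole product. -/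
def seqProd {X : Type*} [MetricSpace X] (A : ℕ → Set X) : Set (EllInfty X) :=
  {x | ∀ k, x k ∈ A k}

/-- `f : ℓ_∞(X) → X` is a contraction: its Lipschitz constant is less than `1`. -/
def IsContraction {X : Type*} [MetricSpace X] (f : EllInfty X → X) : Prop :=
  ∃ C : ℝ≥0, C < 1 ∧ LipschitzWith C f

/-- Condition (C1): for every bounded sequence `(Kₖ)` in the space `𝒦(X)` of nonempty compact
sets (with the Hausdorff metric), the closure of `f(∏ₖ Kₖ)` belongs to `𝒦(X)`. -/
def CondC1 {X : Type*} [MetricSpace X] (f : EllInfty X → X) : Prop :=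
  ∀ K : EllInfty (NonemptyCompacts X), ∃ A : NonemptyCompacts X,
    (A : Set X) = closure (f '' seqProd fun k => (K k : Set X))

/-- A generalized iterated function system of infinite order on `X`: a finite nonempty family
of contractions `ℓ_∞(X) → X` satisfying (C1). -/
structure IsGIFSInfty {X : Type*} [MetricSpace X] (F : Set (EllInfty X → X)) : Prop where
  finite : F.Finite
  nonempty : F.Nonempty
  contraction : ∀ f ∈ F, IsContraction f
  condC1 : ∀ f ∈ F, CondC1 f

/-- The self-similarity equation `A = ⋃_{f ∈ F} closure (f(A × A × ⋯))`. -/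
def IsInvariant {X : Type*} [MetricSpace X] (F : Set (EllInfty X → X))
    (A : NonemptyCompacts X) : Prop :=
  (A : Set X) = ⋃ f ∈ F, closure (f '' seqProd fun _ => (A : Set X))

/-- `A` is the attractor (fractal) of `F`: the unique nonempty compact set satisfying the
self-similarity equation. -/
def IsAttractor {X : Type*} [MetricSpace X] (F : Set (EllInfty X → X))
    (A : NonemptyCompacts X) : Prop :=
  IsInvariant F A ∧ ∀ B : NonemptyCompacts X, IsInvariant F B → B = A

end GIFSInfinity

/-!
A disconnected compact set is, for every `r ∈ (0, 1)`, the attractor of a GIFS of infinite order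
whose maps are `r`-Lipschitz; and in `ℝⁿ` with `n ≥ 1` the disconnected compact sets form a dense
open subset of the space of nonempty compact sets.

Suppose that a compact set `K` splits into two nonempty parts at distance at least `δ > 0`.
Recording in which part each term lies sends a sequence in `K` to its itinerary in `{0,1}^ℕ`, and
two sequences with different itineraries are at distance at least `δ` in the *supremum* metric.
So *every* map from `{0,1}^ℕ` into a set of diameter at most `rδ`, composed with the itinerary,
is `r`-Lipschitz on `K × K × ⋯`. Now cut `K` into finitely many compact pieces of
small diameter: each is the image of `{0,1}^ℕ` by the Hausdorff–Alexandroff theorem, hence the image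
of `K × K × ⋯` under an `r`-Lipschitz map (`exists_lipschitzOnWith_image_seqProd_eq`). Extending
these maps to all of `ℓ_∞(ℝⁿ)` increases the Lipschitz constant by a factor which depends on the
space alone, and is compensated by taking smaller pieces. Condition (C1) is automatic for Lipschitz
maps into a proper space (`condC1_of_lipschitzWith`), and the attractor is unique because the
self-similarity operator contracts the Hausdorff metric (`IsInvariant.eq`).

For `n = 0` there is only one nonempty compact set, and a constant map does.
-/

namespace GIFSInfinity

open Metric Set

/-! ### Maps on bounded sequences -/

section Metric

variable {X : Type*} [MetricSpace X]

/-- A choice of points in uniformly bounded sets is an element of `ℓ_∞`. -/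
lemma exists_mem_seqProd_coe_eq {A : ℕ → Set X} (hA : Bornology.IsBounded (⋃ k, A k))
    {x : ℕ → X} (hx : ∀ k, x k ∈ A k) : ∃ y ∈ seqProd A, ⇑y = x := by
  obtain ⟨C, hC⟩ := isBounded_iff.1 hA
  exact ⟨BoundedContinuousFunction.mkOfDiscrete x C fun i j =>
    hC (mem_iUnion.2 ⟨i, hx i⟩) (mem_iUnion.2 ⟨j, hx j⟩), hx, rfl⟩

lemma isBounded_iUnion_coe (K : EllInfty (NonemptyCompacts X)) :
    Bornology.IsBounded (⋃ k, (K k : Set X)) := by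
  obtain ⟨C, hC⟩ := isBounded_iff.1 K.isBounded_range
  refine ((K 0).isCompact.isBounded.thickening (δ := C + 1)).subset (iUnion_subset fun k x hx => ?_)
  have hlt : hausdorffDist (K k : Set X) (K 0) < C + 1 := by
    rw [← NonemptyCompacts.dist_eq]
    exact (hC (mem_range_self k) (mem_range_self 0)).trans_lt (lt_add_one C)
  obtain ⟨y, hy, hxy⟩ := exists_dist_lt_of_hausdorffDist_lt hx hlt
    (hausdorffEDist_ne_top_of_nonempty_of_bounded (K k).nonempty (K 0).nonempty
      (K k).isCompact.isBounded (K 0).isCompact.isBounded)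
  exact mem_thickening_iff.2 ⟨y, hy, hxy⟩

/-- In a proper space, condition (C1) holds for every Lipschitz map, since such a map sends bounded
sets to relatively compact ones. -/
lemma condC1_of_lipschitzWith [ProperSpace X] {C : ℝ≥0} {f : EllInfty X → X}
    (hf : LipschitzWith C f) : CondC1 f := by
  intro K
  have hK := isBounded_iUnion_coe K
  have hne : (seqProd fun k => (K k : Set X)).Nonempty := by
    obtain ⟨y, hy, -⟩ := exists_mem_seqProd_coe_eq hK fun k => (K k).nonempty.some_mem
    exact ⟨y, hy⟩
  have hbdd : Bornology.IsBounded (seqProd fun k => (K k : Set X)) := by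
    obtain ⟨D, hD⟩ := isBounded_iff.1 hK
    refine isBounded_iff.2 ⟨D, fun x hx y hy =>
      BoundedContinuousFunction.dist_le_iff_of_nonempty.2 fun k => ?_⟩
    exact hD (mem_iUnion.2 ⟨k, hx k⟩) (mem_iUnion.2 ⟨k, hy k⟩)
  exact ⟨⟨⟨closure _, (hf.isBounded_image hbdd).isCompact_closure⟩, (hne.image f).closure⟩, rfl⟩

/-- One half of the fact that the self-similarity operator is a contraction of the Hausdorff metric:
a point of `A` is at distance at most `r * d_H(A, B)` from `B`. -/
lemma IsInvariant.infDist_le {r : ℝ≥0} {F : Set (EllInfty X → X)}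
    (hF : ∀ f ∈ F, LipschitzWith r f) {A B : NonemptyCompacts X} (hA : IsInvariant F A)
    (hB : IsInvariant F B) {a : X} (ha : a ∈ (A : Set X)) :
    infDist a B ≤ r * dist A B := by
  rw [hA, mem_iUnion₂] at ha
  obtain ⟨f, hfF, ha⟩ := ha
  refine closure_minimal ?_ (isClosed_le (continuous_infDist_pt (B : Set X)) continuous_const) ha
  rintro _ ⟨x, hx, rfl⟩
  have hnear : ∀ k, ∃ b ∈ (B : Set X), dist (x k) b ≤ dist A B := fun k => by
    obtain ⟨b, hb, hxb⟩ := B.isCompact.exists_infDist_eq_dist B.nonempty (x k)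
    refine ⟨b, hb, hxb ▸ ?_⟩
    rw [NonemptyCompacts.dist_eq]
    exact infDist_le_hausdorffDist_of_mem (hx k)
      (hausdorffEDist_ne_top_of_nonempty_of_bounded A.nonempty B.nonempty
        A.isCompact.isBounded B.isCompact.isBounded)
  choose b hbB hxb using hnear
  obtain ⟨y, hy, rfl⟩ := exists_mem_seqProd_coe_eq (A := fun _ => (B : Set X))
    (by simpa only [iUnion_const] using B.isCompact.isBounded) hbB
  have hfy : f y ∈ (B : Set X) := by
    rw [hB]
    exact mem_iUnion₂.2 ⟨f, hfF, subset_closure (mem_image_of_mem f hy)⟩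
  calc infDist (f x) B ≤ dist (f x) (f y) := infDist_le_dist_of_mem hfy
    _ ≤ r * dist x y := (hF f hfF).dist_le_mul x y
    _ ≤ r * dist A B := by
      gcongr
      exact BoundedContinuousFunction.dist_le_iff_of_nonempty.2 hxb

lemma IsInvariant.eq {r : ℝ≥0} (hr : r < 1) {F : Set (EllInfty X → X)}
    (hF : ∀ f ∈ F, LipschitzWith r f) {A B : NonemptyCompacts X} (hA : IsInvariant F A)
    (hB : IsInvariant F B) : A = B := by
  have hle : dist A B ≤ r * dist A B := by
    conv_lhs => rw [NonemptyCompacts.dist_eq]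
    refine hausdorffDist_le_of_infDist (by positivity)
      (fun a ha => hA.infDist_le hF hB ha) fun b hb => ?_
    rw [dist_comm]
    exact hB.infDist_le hF hA hb
  have hr' : (r : ℝ) < 1 := by exact_mod_cast hr
  refine dist_le_zero.1 ?_
  nlinarith [dist_nonneg (x := A) (y := B)]

end Metric

/-! ### Disconnected compact sets are attractors -/

section Disconnected

variable {X : Type*} [MetricSpace X]

/-- A disconnected compact set lies in two open sets which it meets and whose traces on it are at
positive distance. -/
lemma exists_open_separated_of_not_isPreconnected {K : Set X} (hK : IsCompact K)
    (hdisc : ¬ IsPreconnected K) :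
    ∃ U : Set X, (K ∩ U).Nonempty ∧ (K \ U).Nonempty ∧
      ∃ δ : ℝ≥0, 0 < δ ∧ ∀ x ∈ K ∩ U, ∀ y ∈ K \ U, (δ : ℝ) ≤ dist x y := by
  rw [IsPreconnected] at hdisc
  push Not at hdisc
  obtain ⟨U, V, hU, hV, hsub, hKU, ⟨v, hvK, hvV⟩, hempty⟩ := hdisc
  have hUV : K ∩ U = K \ V := by
    ext x
    refine ⟨fun hx => ⟨hx.1, fun hxV => ?_⟩, fun hx => ⟨hx.1, (hsub hx.1).resolve_right hx.2⟩⟩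
    exact (hempty ▸ (⟨hx.1, hx.2, hxV⟩ : x ∈ K ∩ (U ∩ V)) : x ∈ (∅ : Set X))
  have hvU : v ∉ U := fun hvU => (hUV.subset ⟨hvK, hvU⟩).2 hvV
  obtain ⟨δ, hδ, hsep⟩ := exists_pos_forall_lt_edist (s := K ∩ U) (t := K \ U)
    (hUV ▸ hK.diff hV) (hK.diff hU).isClosed
    (disjoint_left.2 fun x hx hx' => hx'.2 hx.2)
  refine ⟨U, hKU, ⟨v, hvK, hvU⟩, δ, hδ, fun x hx y hy => ?_⟩
  have h := hsep x hx y hy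
  rw [edist_nndist, ENNReal.coe_lt_coe] at h
  exact_mod_cast h.le

/-- If the parts of `K` inside and outside `U` are `δ`-separated, every nonempty compact set of
diameter at most `c * δ` is the image of `K × K × ⋯` under a `c`-Lipschitz map: that map factors
through the itinerary, which takes equal values at sequences at distance less than `δ`. -/
lemma exists_lipschitzOnWith_image_seqProd_eq {K U : Set X} (hK : Bornology.IsBounded K)
    (hin : (K ∩ U).Nonempty) (hout : (K \ U).Nonempty) {c δ : ℝ≥0}
    (hsep : ∀ x ∈ K ∩ U, ∀ y ∈ K \ U, (δ : ℝ) ≤ dist x y)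
    {P : Set X} (hP : IsCompact P) (hne : P.Nonempty)
    (hdiam : ∀ p ∈ P, ∀ q ∈ P, dist p q ≤ c * δ) :
    ∃ f : EllInfty X → X, LipschitzOnWith c f (seqProd fun _ => K) ∧
      f '' (seqProd fun _ => K) = P := by
  classical
  have : CompactSpace P := isCompact_iff_compactSpace.1 hP
  have : Nonempty P := hne.to_subtype
  obtain ⟨g, -, hg⟩ := exists_nat_bool_continuous_surjective_of_compact P
  let itin (x : EllInfty X) : ℕ → Bool := fun k => decide (x k ∈ U)
  refine ⟨fun x => g (itin x), LipschitzOnWith.of_dist_le_mul fun x hx y hy => ?_, ?_⟩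
  · by_cases hxy : itin x = itin y
    · rw [hxy, dist_self]
      positivity
    obtain ⟨k, hk⟩ := Function.ne_iff.1 hxy
    have hδ : (δ : ℝ) ≤ dist (x k) (y k) := by
      by_cases hxU : x k ∈ U <;> by_cases hyU : y k ∈ U
      · simp [itin, hxU, hyU] at hk
      · exact hsep _ ⟨hx k, hxU⟩ _ ⟨hy k, hyU⟩
      · rw [dist_comm]
        exact hsep _ ⟨hy k, hyU⟩ _ ⟨hx k, hxU⟩
      · simp [itin, hxU, hyU] at hk
    calc dist (g (itin x) : X) (g (itin y)) ≤ c * δ := hdiam _ (g _).2 _ (g _).2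
      _ ≤ c * dist x y := by
        gcongr
        exact hδ.trans (BoundedContinuousFunction.dist_coe_le_dist k)
  · refine Subset.antisymm (image_subset_iff.2 fun x _ => (g (itin x)).2) fun p hp => ?_
    obtain ⟨s, hs⟩ := hg ⟨p, hp⟩
    obtain ⟨u, huK, huU⟩ := hin
    obtain ⟨v, hvK, hvU⟩ := hout
    obtain ⟨x, hx, hxs⟩ := exists_mem_seqProd_coe_eq (A := fun _ => K)
      (by simpa only [iUnion_const] using hK) (x := fun k => if s k then u else v)
      (fun k => by split_ifs <;> assumption)
    refine ⟨x, hx, ?_⟩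
    have hitin : itin x = s := by
      funext k
      cases hk : s k <;> simp [itin, hxs, hk, huU, hvU]
    simp only [hitin, hs]

variable {E : Type*} [NormedAddCommGroup E] [NormedSpace ℝ E] [FiniteDimensional ℝ E]

theorem exists_isAttractor_of_not_isPreconnected {K : NonemptyCompacts E}
    (hdisc : ¬ IsPreconnected (K : Set E)) {r : ℝ≥0} (hr0 : 0 < r) (hr1 : r < 1) :
    ∃ F : Set (EllInfty E → E), IsGIFSInfty F ∧ IsAttractor F K ∧ ∀ f ∈ F, LipschitzWith r f := by
  have : ProperSpace E := FiniteDimensional.proper ℝ E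
  obtain ⟨U, hin, hout, δ, hδ, hsep⟩ :=
    exists_open_separated_of_not_isPreconnected K.isCompact hdisc
  have hL := lipschitzExtensionConstant_pos E
  -- Extending a map to all of `ℓ_∞(E)` multiplies its Lipschitz constant by
  -- `lipschitzExtensionConstant E`, so the map on `K × K × ⋯` is taken `c`-Lipschitz.
  let c : ℝ≥0 := r / lipschitzExtensionConstant E
  have hc : lipschitzExtensionConstant E * c = r := mul_div_cancel₀ r hL.ne'
  have hcpos : 0 < c := div_pos hr0 hL
  have hcδ : (0 : ℝ) < c * δ / 2 := by positivity
  obtain ⟨t, htK, htfin, hcover⟩ := K.isCompact.finite_cover_balls hcδ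
  have hmaps : ∀ z : E, ∃ f : EllInfty E → E, z ∈ t → LipschitzWith r f ∧
      f '' (seqProd fun _ => (K : Set E)) = (K : Set E) ∩ closedBall z (c * δ / 2) := fun z => by
    by_cases hz : z ∈ t
    · obtain ⟨f, hf, himg⟩ := exists_lipschitzOnWith_image_seqProd_eq (c := c)
        K.isCompact.isBounded hin hout hsep
        (K.isCompact.inter_right (isClosed_closedBall (x := z) (ε := c * δ / 2)))
        ⟨z, htK hz, mem_closedBall_self hcδ.le⟩
        (fun p hp q hq => (dist_triangle_right p q z).trans
          ((add_le_add hp.2 hq.2).trans_eq (add_halves _)))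
      obtain ⟨g, hg, hfg⟩ := hf.extend_finite_dimension
      exact ⟨g, fun _ => ⟨hc ▸ hg, by rw [← himg]; exact hfg.image_eq.symm⟩⟩
    · exact ⟨fun _ => 0, fun h => absurd h hz⟩
  choose f hf using hmaps
  have hlip : ∀ g ∈ f '' t, LipschitzWith r g := by
    rintro _ ⟨z, hz, rfl⟩
    exact (hf z hz).1
  have hclosure : ∀ z ∈ t, closure (f z '' seqProd fun _ => (K : Set E)) =
      (K : Set E) ∩ closedBall z (c * δ / 2) := fun z hz => by
    rw [(hf z hz).2]
    exact (K.isCompact.isClosed.inter isClosed_closedBall).closure_eq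
  have hinv : IsInvariant (f '' t) K := by
    rw [IsInvariant, biUnion_image, iUnion₂_congr hclosure, ← inter_iUnion₂, eq_comm,
      inter_eq_left]
    exact hcover.trans (iUnion₂_mono fun z _ => ball_subset_closedBall)
  refine ⟨f '' t, ⟨htfin.image f, ?_, fun g hg => ⟨r, hr1, hlip g hg⟩,
    fun g hg => condC1_of_lipschitzWith (hlip g hg)⟩,
    ⟨hinv, fun B hB => hB.eq hr1 hlip hinv⟩, hlip⟩
  obtain ⟨p, hp⟩ := K.nonempty
  obtain ⟨z, hz, -⟩ := mem_iUnion₂.1 (hcover hp)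
  exact ⟨f z, z, hz, rfl⟩

theorem exists_isAttractor_of_subsingleton [Subsingleton X] (K : NonemptyCompacts X) (r : ℝ≥0) :
    ∃ F : Set (EllInfty X → X), IsGIFSInfty F ∧ IsAttractor F K ∧ ∀ f ∈ F, LipschitzWith r f := by
  obtain ⟨p, hp⟩ := K.nonempty
  have hlip (s : ℝ≥0) : LipschitzWith s fun _ : EllInfty X => p := LipschitzWith.const' p
  have huniv (B : NonemptyCompacts X) : (B : Set X) = univ :=
    Subsingleton.eq_univ_of_nonempty B.nonempty
  have hne : (seqProd fun _ => (K : Set X)).Nonempty :=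
    ⟨BoundedContinuousFunction.const ℕ p, fun _ => hp⟩
  refine ⟨{fun _ => p}, ⟨finite_singleton _, singleton_nonempty _, ?_, ?_⟩,
    ⟨?_, fun B _ => SetLike.coe_injective ((huniv B).trans (huniv K).symm)⟩, ?_⟩
  · rintro _ rfl
    exact ⟨0, zero_lt_one, hlip 0⟩
  · rintro _ rfl
    exact condC1_of_lipschitzWith (hlip 0)
  · rw [IsInvariant, biUnion_singleton, huniv K]
    rw [huniv K] at hne
    exact (Subsingleton.eq_univ_of_nonempty (hne.image _).closure).symm
  · rintro _ rfl
    exact hlip r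

end Disconnected

/-! ### Disconnected compact sets are typical -/

section Typical

lemma isOpen_setOf_not_isPreconnected {X : Type*} [MetricSpace X] :
    IsOpen {K : NonemptyCompacts X | ¬ IsPreconnected (K : Set X)} := by
  refine Metric.isOpen_iff.2 fun K hK => ?_
  obtain ⟨U, ⟨u, huK, huU⟩, ⟨v, hvK, hvU⟩, δ, hδ, hsep⟩ :=
    exists_open_separated_of_not_isPreconnected K.isCompact hK
  have hδ' : (0 : ℝ) < δ / 2 := by positivity
  -- A set closer than `δ / 2` to `K` lies in the `δ / 2`-neighbourhoods of the two parts of `K`,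
  -- which are disjoint, and meets both.
  refine ⟨δ / 2, hδ', fun L hL hconn => ?_⟩
  rw [mem_ball, NonemptyCompacts.dist_eq] at hL
  have hfin := hausdorffEDist_ne_top_of_nonempty_of_bounded L.nonempty K.nonempty
    L.isCompact.isBounded K.isCompact.isBounded
  obtain ⟨a, haL, hau⟩ := exists_dist_lt_of_hausdorffDist_lt' huK hL hfin
  obtain ⟨b, hbL, hbv⟩ := exists_dist_lt_of_hausdorffDist_lt' hvK hL hfin
  obtain ⟨z, -, hz₁, hz₂⟩ := hconn (thickening (δ / 2) (K ∩ U)) (thickening (δ / 2) (K \ U))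
    isOpen_thickening isOpen_thickening (fun x hx => by
      obtain ⟨y, hyK, hxy⟩ := exists_dist_lt_of_hausdorffDist_lt hx hL hfin
      by_cases hyU : y ∈ U
      · exact Or.inl (mem_thickening_iff.2 ⟨y, ⟨hyK, hyU⟩, hxy⟩)
      · exact Or.inr (mem_thickening_iff.2 ⟨y, ⟨hyK, hyU⟩, hxy⟩))
    ⟨a, haL, mem_thickening_iff.2 ⟨u, ⟨huK, huU⟩, hau⟩⟩
    ⟨b, hbL, mem_thickening_iff.2 ⟨v, ⟨hvK, hvU⟩, hbv⟩⟩
  obtain ⟨p, hp, hzp⟩ := mem_thickening_iff.1 hz₁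
  obtain ⟨q, hq, hzq⟩ := mem_thickening_iff.1 hz₂
  linarith [hsep p hp q hq, dist_triangle_left p q z]

/-- In a space without isolated points, a compact set is approximated by a finite net of it with one
point added, so by finite sets with more than one point. -/
lemma dense_setOf_not_isPreconnected {X : Type*} [MetricSpace X]
    [∀ x : X, (nhdsWithin x {x}ᶜ).NeBot] :
    Dense {K : NonemptyCompacts X | ¬ IsPreconnected (K : Set X)} := by
  intro K
  refine Metric.mem_closure_iff.2 fun ε hε => ?_
  have hε' : 0 < ε / 2 := half_pos hε
  obtain ⟨t, htK, htfin, hcover⟩ := K.isCompact.finite_cover_balls hε'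
  obtain ⟨p, hp⟩ := K.nonempty
  obtain ⟨q, hqp, hq⟩ : ∃ q ∈ ({p}ᶜ : Set X), dist q p < ε / 2 := by
    have h := inter_mem_nhdsWithin ({p}ᶜ : Set X) (ball_mem_nhds p hε')
    exact (Filter.nonempty_of_mem h).imp fun q hq => hq
  have hSfin : (insert q (insert p t)).Finite := (htfin.insert p).insert q
  have hpS : p ∈ insert q (insert p t) := mem_insert_of_mem q (mem_insert p t)
  refine ⟨⟨⟨_, hSfin.isCompact⟩, ⟨p, hpS⟩⟩, fun hconn => ?_, ?_⟩
  · exact hconn.infinite_of_nontrivial ⟨q, mem_insert _ _, p, hpS, hqp⟩ hSfin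
  · rw [NonemptyCompacts.dist_eq]
    refine (hausdorffDist_le_of_mem_dist hε'.le (fun x hx => ?_) fun x hx => ?_).trans_lt
      (half_lt_self hε)
    · obtain ⟨z, hz, hxz⟩ := mem_iUnion₂.1 (hcover hx)
      exact ⟨z, mem_insert_of_mem q (mem_insert_of_mem p hz), (mem_ball.1 hxz).le⟩
    · rcases hx with rfl | rfl | hx
      · exact ⟨p, hp, hq.le⟩
      · exact ⟨x, hp, (dist_self x).trans_le hε'.le⟩
      · exact ⟨x, htK hx, (dist_self x).trans_le hε'.le⟩

end Typical

end GIFSInfinity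

/-- The typical nonempty compact set in `ℝⁿ` (typical: outside a meager subset of the space of
nonempty compact sets with the Hausdorff metric) is, for every `r ∈ (0,1)`, the attractor of a
GIFS of infinite order whose maps have Lipschitz constant at most `r`. -/
theorem mainTheorem2 (n : ℕ) :
    ∀ᶠ K : NonemptyCompacts (EuclideanSpace ℝ (Fin n)) in
      residual (NonemptyCompacts (EuclideanSpace ℝ (Fin n))),
      ∀ r : ℝ≥0, 0 < r → r < 1 →
        ∃ F : Set (GIFSInfinity.EllInfty (EuclideanSpace ℝ (Fin n)) →
            EuclideanSpace ℝ (Fin n)),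
          GIFSInfinity.IsGIFSInfty F ∧ GIFSInfinity.IsAttractor F K ∧
            ∀ f ∈ F, LipschitzWith r f := by
  cases subsingleton_or_nontrivial (EuclideanSpace ℝ (Fin n)) with
  | inl h =>
    exact .of_forall fun K r _ _ => GIFSInfinity.exists_isAttractor_of_subsingleton K r
  | inr h =>
    have (x : EuclideanSpace ℝ (Fin n)) : (nhdsWithin x {x}ᶜ).NeBot :=
      Module.punctured_nhds_neBot ℝ (EuclideanSpace ℝ (Fin n)) x
    filter_upwards [residual_of_dense_open GIFSInfinity.isOpen_setOf_not_isPreconnected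
      GIFSInfinity.dense_setOf_not_isPreconnected] with K hK r hr0 hr1
    exact GIFSInfinity.exists_isAttractor_of_not_isPreconnected hK hr0 hr1
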